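/- Let $X$ be an infinite-dimensional complex Banach space and let $T\in\mathcal{B}(X)$ be a bounded linear operator whose spectrum $\sigma(T)$ is (at most) countable and which has no eigenvalues, i.e. $\lambda-T$ is injective for every $\lambda\in\mathbb{C}$. A halfspace of $X$ is a norm-closed linear subspace $Y\subseteq X$ with $\dim Y=\dim(X/Y)=\infty$; it is an invariant halfspace under $S\in\mathcal{B}(X)$ if moreover $SY\subseteq Y$. For $x\in X$ write $[x]$ for the linear span of $x$. Then for every nonzero $x\in X$ and every $\varepsilon>0$ there exists $F\in\mathcal{B}(X)$ with $\|F\|<\varepsilon$ and range equal to $[x]$ such that $T-F$ admits an invariant halfspace $Y$; this $Y$ satisfies $TY\subseteq Y+[x]$. -/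

import Mathlib

/-- The point spectrum of a bounded operator: all `μ` for which `μ - T` is not injective. -/
def pointSpectrum {X : Type*} [NormedAddCommGroup X] [NormedSpace ℂ X] (T : X →L[ℂ] X) :
    Set ℂ :=
  {μ | ¬ Function.Injective (fun y : X => μ • y - T y)}

/-- A halfspace: a norm-closed subspace of infinite dimension and infinite codimension. -/
structure IsHalfspace {X : Type*} [NormedAddCommGroup X] [NormedSpace ℂ X]
    (Y : Submodule ℂ X) : Prop where
  isClosed : IsClosed (Y : Set X)
  infinite_dim : ¬ FiniteDimensional ℂ Y
  infinite_codim : ¬ FiniteDimensional ℂ (X ⧸ Y)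

/-- An invariant halfspace (IHS) under `S`: a halfspace `Y` with `S Y ⊆ Y`. -/
structure IsInvariantHalfspace {X : Type*} [NormedAddCommGroup X] [NormedSpace ℂ X]
    (S : X →L[ℂ] X) (Y : Submodule ℂ X) : Prop where
  isHalfspace : IsHalfspace Y
  invariant : ∀ y ∈ Y, S y ∈ Y

open Filter Topology NormedSpace

/-- **Mazur's lemma**: if a norming family of functionals tends to zero along `w`, then eventually
`w n` is almost orthogonal to a given finite-dimensional subspace. -/
theorem eventually_norm_le_norm_add_smul {Z ι : Type*} [NormedAddCommGroup Z] [NormedSpace ℂ Z]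
    {D : Set (StrongDual ℂ Z)} (hD : ∀ φ ∈ D, ‖φ‖ ≤ 1)
    (hnorming : ∀ v : Z, ∀ r < ‖v‖, ∃ φ ∈ D, r < ‖φ v‖)
    {U : Filter ι} {w : ι → Z} (hw : ∀ φ ∈ D, Tendsto (fun n => φ (w n)) U (𝓝 0))
    {c : ℝ} (hc : 0 < c) (hcw : ∀ n, c ≤ ‖w n‖)
    (E : Submodule ℂ Z) [FiniteDimensional ℂ E] {η : ℝ} (hη : 0 < η) :
    ∀ᶠ n in U, ∀ e ∈ E, ∀ a : ℂ, (1 - η) * ‖e‖ ≤ ‖e + a • w n‖ := by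
  have hcompact : IsCompact ((↑) '' (Metric.sphere (0 : E) 1) : Set Z) :=
    (isCompact_sphere (0 : E) 1).image continuous_subtype_val
  obtain ⟨t, ht⟩ := hcompact.elim_finite_subcover
    (fun φ : D => {v : Z | 1 - η / 2 < ‖(φ : StrongDual ℂ Z) v‖})
    (fun φ => isOpen_lt continuous_const (φ : StrongDual ℂ Z).continuous.norm) (by
      rintro _ ⟨e, he, rfl⟩
      have he1 : ‖(e : Z)‖ = 1 := by simpa using he
      obtain ⟨φ, hφ, hlt⟩ := hnorming e (1 - η / 2) (by linarith)
      exact Set.mem_iUnion.2 ⟨⟨φ, hφ⟩, hlt⟩)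
  have hev : ∀ᶠ n in U, ∀ φ ∈ t, ‖(φ : StrongDual ℂ Z) (w n)‖ < c * η / 4 := by
    rw [eventually_all_finset]
    intro φ _
    have := (hw φ φ.2).norm
    rw [norm_zero] at this
    exact this.eventually_lt_const (by positivity)
  filter_upwards [hev] with n hn
  have key : ∀ e ∈ E, ‖e‖ = 1 → ∀ a : ℂ, 1 - η ≤ ‖e + a • w n‖ := by
    intro e he he1 a
    rcases le_or_gt 2 (‖a‖ * c) with h | h
    · have h1 : ‖a • w n‖ ≤ ‖e + a • w n‖ + ‖e‖ := by
        simpa using norm_sub_le (e + a • w n) e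
      rw [norm_smul] at h1
      have := mul_le_mul_of_nonneg_left (hcw n) (norm_nonneg a)
      linarith
    · obtain ⟨φ, hφt, hφ⟩ : ∃ φ ∈ t, 1 - η / 2 < ‖(φ : StrongDual ℂ Z) e‖ := by
        have := ht ⟨⟨e, he⟩, by simpa using he1, rfl⟩
        simpa using this
      have h1 : ‖(φ : StrongDual ℂ Z) e‖ ≤
          ‖(φ : StrongDual ℂ Z) (e + a • w n)‖ + ‖a • (φ : StrongDual ℂ Z) (w n)‖ := by
        simpa using norm_sub_le ((φ : StrongDual ℂ Z) (e + a • w n))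
          (a • (φ : StrongDual ℂ Z) (w n))
      have h2 := (φ : StrongDual ℂ Z).le_of_opNorm_le (hD φ φ.2) (e + a • w n)
      rw [norm_smul] at h1
      have h3 : ‖a‖ * ‖(φ : StrongDual ℂ Z) (w n)‖ ≤ ‖a‖ * (c * η / 4) :=
        mul_le_mul_of_nonneg_left (hn φ hφt).le (norm_nonneg a)
      nlinarith
  intro e he a
  by_cases he0 : e = 0
  · simp [he0]
  have hpos : 0 < ‖e‖ := norm_pos_iff.2 he0
  have h := key (((‖e‖ : ℂ)⁻¹) • e) (E.smul_mem _ he) (by simp [norm_smul, hpos.ne'])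
    ((‖e‖ : ℂ)⁻¹ * a)
  rw [mul_smul, ← smul_add, norm_smul, norm_inv, Complex.norm_real, norm_norm,
    inv_mul_eq_div, le_div_iff₀ hpos] at h
  exact h

/-- A sequence that is eventually almost orthogonal to every finite-dimensional subspace has a
subsequence with uniformly bounded coefficient functionals. -/
theorem exists_subseq_coeff_bound {Z : Type*} [NormedAddCommGroup Z] [NormedSpace ℂ Z]
    {U : Filter ℕ} [U.NeBot] {w : ℕ → Z} {c : ℝ} (hc : 0 < c) (hcw : ∀ n, c ≤ ‖w n‖)
    (hw : ∀ (E : Submodule ℂ Z) [FiniteDimensional ℂ E] (η : ℝ), 0 < η →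
      ∀ᶠ n in U, ∀ e ∈ E, ∀ a : ℂ, (1 - η) * ‖e‖ ≤ ‖e + a • w n‖)
    {P : ℕ → ℕ → Prop} (hP : ∀ k, ∀ᶠ n in U, P k n) :
    ∃ φ : ℕ → ℕ, (∀ k, P k (φ k)) ∧ ∀ (a : ℕ → ℂ) (N k : ℕ), k < N →
      ‖a k‖ ≤ 4 / c * ‖∑ i ∈ Finset.range N, a i • w (φ i)‖ := by
  classical
  set r : ℕ → ℝ := fun k => 2 - (1 / 2) ^ k with hr
  have hr1 : ∀ k, 1 ≤ r k := fun k => by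
    have : ((1 : ℝ) / 2) ^ k ≤ 1 := pow_le_one₀ (by norm_num) (by norm_num)
    simp only [hr]; linarith
  have hr2 : ∀ k, r k ≤ 2 := fun k => by
    have : 0 ≤ ((1 : ℝ) / 2) ^ k := by positivity
    simp only [hr]; linarith
  have hrlt : ∀ k, r k < r (k + 1) := fun k => by
    have : 0 < ((1 : ℝ) / 2) ^ k := by positivity
    simp only [hr, pow_succ]; linarith
  have step : ∀ (k : ℕ) (s : Finset ℕ), ∃ n, P k n ∧
      ∀ e ∈ Submodule.span ℂ (w '' (s : Set ℕ)), ∀ a : ℂ,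
        r k * ‖e‖ ≤ r (k + 1) * ‖e + a • w n‖ := by
    intro k s
    have : FiniteDimensional ℂ (Submodule.span ℂ (w '' (s : Set ℕ))) :=
      FiniteDimensional.span_of_finite ℂ (s.finite_toSet.image w)
    have hpos : 0 < r (k + 1) := by linarith [hr1 (k + 1)]
    obtain ⟨n, hn, hn'⟩ := ((hP k).and (hw (Submodule.span ℂ (w '' (s : Set ℕ)))
      (1 - r k / r (k + 1)) (by
        rw [sub_pos, div_lt_one hpos]; exact hrlt k))).exists
    refine ⟨n, hn, fun e he a => ?_⟩
    have := hn' e he a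
    rw [sub_sub_cancel, div_mul_eq_mul_div, div_le_iff₀ hpos] at this
    linarith
  choose G hG hG' using step
  obtain ⟨s, hs⟩ : ∃ s : ℕ → Finset ℕ, ∀ k, s (k + 1) = insert (G k (s k)) (s k) :=
    ⟨fun k => Nat.rec ∅ (fun k t => insert (G k t) t) k, fun _ => rfl⟩
  let φ : ℕ → ℕ := fun k => G k (s k)
  have hmem : ∀ N, ∀ i < N, φ i ∈ s N := by
    intro N
    induction N with
    | zero => simp
    | succ N ih =>
      intro i hi
      rw [hs]
      rcases Nat.lt_succ_iff_lt_or_eq.1 hi with h | rfl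
      · exact Finset.mem_insert_of_mem (ih i h)
      · exact Finset.mem_insert_self _ _
  refine ⟨φ, fun k => hG k (s k), fun a N k hk => ?_⟩
  set v : ℕ → Z := fun N => ∑ i ∈ Finset.range N, a i • w (φ i) with hv
  have hvmem : ∀ N : ℕ, v N ∈ Submodule.span ℂ (w '' (↑(s N) : Set ℕ)) := fun N => by
    refine Submodule.sum_mem _ fun i hi => Submodule.smul_mem _ _ (Submodule.subset_span ?_)
    exact (Set.mem_image_of_mem w (Finset.mem_coe.2 (hmem N i (Finset.mem_range.1 hi))))
  have hvs : ∀ N, v (N + 1) = v N + a N • w (φ N) := fun N => Finset.sum_range_succ _ _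
  have hmono : Monotone fun N => r N * ‖v N‖ := monotone_nat_of_le_succ fun N => by
    rw [hvs]; exact hG' N (s N) _ (hvmem N) _
  have hle : ∀ j ≤ N, ‖v j‖ ≤ 2 * ‖v N‖ := fun j hj => by
    have h1 := hmono hj
    have h2 := mul_le_mul_of_nonneg_right (hr1 j) (norm_nonneg (v j))
    have h3 := mul_le_mul_of_nonneg_right (hr2 N) (norm_nonneg (v N))
    simp only at h1
    linarith
  have h1 : ‖a k • w (φ k)‖ ≤ ‖v (k + 1)‖ + ‖v k‖ := by
    simpa [hvs] using norm_sub_le (v (k + 1)) (v k)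
  rw [norm_smul] at h1
  have h2 := mul_le_mul_of_nonneg_left (hcw (φ k)) (norm_nonneg (a k))
  rw [div_mul_eq_mul_div, le_div_iff₀ hc]
  linarith [hle (k + 1) hk, hle k hk.le]

/-- If a complete space `X` embeds isometrically in the dual of `V`, then the kernel of a functional
on `V` that does not come from a nonzero vector of `X` norms `X` up to a constant. -/
theorem exists_norm_le_mul_norm_restrict_ker {X V : Type*} [NormedAddCommGroup X] [NormedSpace ℂ X]
    [CompleteSpace X] [NormedAddCommGroup V] [NormedSpace ℂ V] (J : X →ₗᵢ[ℂ] StrongDual ℂ V)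
    (z : StrongDual ℂ V) (hz : ∀ v : X, J v = z → v = 0) :
    ∃ C : ℝ, 0 < C ∧ ∀ v : X, ‖v‖ ≤
      C * ‖(J v).comp (LinearMap.ker z.toLinearMap).subtypeL‖ := by
  have hJc : IsClosed (Set.range J) := J.isometry.isClosedEmbedding.isClosed_range
  obtain ⟨d, hd, hdJ⟩ : ∃ d : ℝ, 0 < d ∧ ∀ (v : X) (a : ℂ), ‖a‖ * d * ‖z‖ ≤ ‖J v - a • z‖ := by
    by_cases hz0 : z = 0
    · exact ⟨1, one_pos, by simp [hz0]⟩
    have hnot : z ∉ Set.range J := by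
      rintro ⟨v, hv⟩
      have : v = 0 := hz v hv
      exact hz0 (by rw [← hv, this, map_zero])
    have hpos := (hJc.notMem_iff_infDist_pos (Set.range_nonempty J)).1 hnot
    have hzpos : 0 < ‖z‖ := norm_pos_iff.2 hz0
    refine ⟨Metric.infDist z (Set.range J) / ‖z‖, by positivity, fun v a => ?_⟩
    rw [mul_assoc, div_mul_cancel₀ _ hzpos.ne']
    by_cases ha : a = 0
    · simp [ha]
    have h := Metric.infDist_le_dist_of_mem (x := z) (Set.mem_range_self (f := J) (a⁻¹ • v))
    rw [dist_eq_norm] at h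
    calc ‖a‖ * Metric.infDist z (Set.range J) ≤ ‖a‖ * ‖z - J (a⁻¹ • v)‖ :=
          mul_le_mul_of_nonneg_left h (norm_nonneg a)
      _ = ‖J v - a • z‖ := by
          rw [← norm_smul, smul_sub, map_smul, smul_smul, mul_inv_cancel₀ ha, one_smul,
            norm_sub_rev]
  refine ⟨1 + 1 / d, by positivity, fun v => ?_⟩
  set K := LinearMap.ker z.toLinearMap
  obtain ⟨ψ, hψ, hψn⟩ := exists_extension_norm_eq K ((J v).comp K.subtypeL)
  rw [← hψn]
  obtain ⟨a, ha⟩ : ∃ a : ℂ, J v - ψ = a • z := by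
    have hle : LinearMap.ker z.toLinearMap ≤ LinearMap.ker (J v - ψ).toLinearMap := by
      intro g hg
      have := hψ ⟨g, hg⟩
      simp only [LinearMap.mem_ker, ContinuousLinearMap.coe_coe, sub_apply]
      rw [this]
      exact sub_self _
    by_cases hz0 : z = 0
    · refine ⟨0, ?_⟩
      ext g
      have : g ∈ LinearMap.ker (J v - ψ).toLinearMap := hle (by simp [hz0])
      simpa using this
    obtain ⟨g, hg⟩ : ∃ g, z g ≠ 0 := by
      by_contra! h
      exact hz0 (ContinuousLinearMap.ext h)
    refine ⟨(J v - ψ) g / z g, ?_⟩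
    ext u
    have hu : u - (z u / z g) • g ∈ LinearMap.ker (J v - ψ).toLinearMap := hle (by
      simp [hg])
    rw [LinearMap.mem_ker, map_sub, map_smul, sub_eq_zero] at hu
    change (J v - ψ) u = (z u / z g) * (J v - ψ) g at hu
    rw [hu]
    change _ = (J v - ψ) g / z g * z u
    ring
  have hψ' : ψ = J v - a • z := by rw [← ha]; abel
  have h1 := hdJ v a
  rw [← hψ'] at h1
  have h2 : ‖v‖ ≤ ‖ψ‖ + ‖a‖ * ‖z‖ := by
    rw [← J.norm_map v, ← norm_smul, hψ']
    simpa using norm_add_le (J v - a • z) (a • z)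
  have h3 : ‖a‖ * ‖z‖ ≤ 1 / d * ‖ψ‖ := by
    rw [one_div, inv_mul_eq_div, le_div_iff₀ hd]; linarith
  linarith

/-- Weak-star limits of bounded sequences along an ultrafilter exist in the double dual. -/
theorem exists_tendsto_dual_apply {X : Type*} [NormedAddCommGroup X] [NormedSpace ℂ X]
    (U : Ultrafilter ℕ) {y : ℕ → X} (hy : ∀ n, ‖y n‖ = 1) :
    ∃ z : StrongDual ℂ (StrongDual ℂ X),
      ∀ f : StrongDual ℂ X, Tendsto (fun n => f (y n)) U (𝓝 (z f)) := by
  have hc := WeakDual.isCompact_closedBall (𝕜 := ℂ) (E := StrongDual ℂ X) 0 1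
  obtain ⟨z, -, hz⟩ := hc.ultrafilter_le_nhds
    (U.map fun n => StrongDual.toWeakDual (inclusionInDoubleDual ℂ X (y n))) (by
      rw [Ultrafilter.coe_map, le_principal_iff, mem_map]
      refine Eventually.of_forall fun n => ?_
      have := double_dual_bound ℂ X (y n)
      rw [hy] at this
      simpa using this)
  refine ⟨WeakDual.toStrongDual z, fun f => ?_⟩
  have h : Tendsto (fun n => StrongDual.toWeakDual (inclusionInDoubleDual ℂ X (y n))) U (𝓝 z) := hz
  exact ((WeakDual.eval_continuous f).tendsto z).comp h

/-- If a complete space `X` embeds isometrically in the dual of `V`, then a normalized sequence in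
`X` converging pointwise on `V` to a functional that does not come from a nonzero vector of `X` has
subsequences with uniformly bounded coefficient functionals. -/
theorem exists_bound_forall_exists_subseq {X V : Type*} [NormedAddCommGroup X] [NormedSpace ℂ X]
    [CompleteSpace X] [NormedAddCommGroup V] [NormedSpace ℂ V] (J : X →ₗᵢ[ℂ] StrongDual ℂ V)
    {U : Filter ℕ} [U.NeBot] {y : ℕ → X} (hy : ∀ n, ‖y n‖ = 1) {z : StrongDual ℂ V}
    (hyz : ∀ f : V, Tendsto (fun n => J (y n) f) U (𝓝 (z f)))
    (hz : ∀ v : X, J v = z → v = 0) :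
    ∃ C : ℝ, 0 < C ∧ ∀ P : ℕ → ℕ → Prop, (∀ k, ∀ᶠ n in U, P k n) →
      ∃ φ : ℕ → ℕ, (∀ k, P k (φ k)) ∧ ∀ (a : ℕ → ℂ) (N k : ℕ), k < N →
        ‖a k‖ ≤ C * ‖∑ i ∈ Finset.range N, a i • y (φ i)‖ := by
  obtain ⟨C, hC, hCv⟩ := exists_norm_le_mul_norm_restrict_ker J z hz
  set K := LinearMap.ker z.toLinearMap
  let R : X →ₗ[ℂ] StrongDual ℂ K :=
    { toFun := fun v => (J v).comp K.subtypeL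
      map_add' := fun u v => by ext; simp
      map_smul' := fun a v => by ext; simp }
  have hRle : ∀ v, ‖R v‖ ≤ ‖v‖ := fun v =>
    ContinuousLinearMap.opNorm_le_bound _ (norm_nonneg v) fun g => by
      have := (J v).le_opNorm g
      rw [J.norm_map] at this
      exact this
  have hRge : ∀ n, 1 / C ≤ ‖R (y n)‖ := fun n => by
    have := hCv (y n)
    rw [hy] at this
    rw [div_le_iff₀ hC, mul_comm]
    exact this
  have mazur := fun (E : Submodule ℂ (StrongDual ℂ K)) (_ : FiniteDimensional ℂ E) (η : ℝ)
      (hη : 0 < η) => eventually_norm_le_norm_add_smul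
    (D := {ψ | ∃ g : K, ‖g‖ ≤ 1 ∧ ψ = inclusionInDoubleDual ℂ K g}) (by
      rintro _ ⟨g, hg, rfl⟩
      exact (double_dual_bound ℂ K g).trans hg) (by
      intro v r hr
      obtain ⟨g, hg, hlt⟩ := v.exists_lt_apply_of_lt_opNorm hr
      exact ⟨_, ⟨g, hg.le, rfl⟩, hlt⟩)
    (U := U) (w := fun n => R (y n)) (by
      rintro _ ⟨g, -, rfl⟩
      have := hyz g
      rwa [show z g = 0 from g.2] at this) (c := 1 / C) (by positivity) hRge E hη
  refine ⟨4 / (1 / C), by positivity, fun P hP => ?_⟩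
  obtain ⟨φ, hφ, hb⟩ := exists_subseq_coeff_bound (U := U)
    (w := fun n => R (y n)) (c := 1 / C) (by positivity) hRge
    (fun E _ η hη => mazur E ‹_› η hη) hP
  refine ⟨φ, hφ, fun a N k hk => (hb a N k hk).trans ?_⟩
  gcongr
  have := hRle (∑ i ∈ Finset.range N, a i • y (φ i))
  rwa [map_sum, Finset.sum_congr rfl fun i _ => map_smul R (a i) (y (φ i))] at this

/-- Prescribing the values of a functional on a sequence with bounded coefficient functionals. -/
theorem exists_dual_apply_eq {X : Type*} [NormedAddCommGroup X] [NormedSpace ℂ X]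
    {u : ℕ → X} {C : ℝ} (hC : 0 < C)
    (hu : ∀ (a : ℕ → ℂ) (N k : ℕ), k < N → ‖a k‖ ≤ C * ‖∑ i ∈ Finset.range N, a i • u i‖)
    {b : ℕ → ℂ} {B : ℝ} (hB : ∀ N, ∑ i ∈ Finset.range N, ‖b i‖ ≤ B) :
    ∃ f : StrongDual ℂ X, ‖f‖ ≤ C * B ∧ ∀ k, f (u k) = b k := by
  have hB0 : 0 ≤ B := by simpa using hB 0
  have hsum : ∀ (M : Type _) [AddCommGroup M] [Module ℂ M] (m : ℕ → M) (a : ℕ →₀ ℂ),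
      ∃ N, (∀ k ∈ a.support, k < N) ∧
        Finsupp.linearCombination ℂ m a = ∑ i ∈ Finset.range N, a i • m i := by
    intro M _ _ m a
    refine ⟨a.support.sup id + 1, fun k hk => Nat.lt_succ_of_le (Finset.le_sup (f := id) hk), ?_⟩
    rw [Finsupp.linearCombination_apply, Finsupp.sum_of_support_subset _ _ _ (by simp)]
    intro k hk
    exact Finset.mem_range.2 (Nat.lt_succ_of_le (Finset.le_sup (f := id) hk))
  have hli : LinearIndependent ℂ u := by
    rw [linearIndependent_iff]
    intro a ha
    obtain ⟨N, hN, hN'⟩ := hsum X u a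
    ext k
    by_contra hk
    have h := hu a N k (hN k (Finsupp.mem_support_iff.2 hk))
    rw [← hN', ha, norm_zero, mul_zero] at h
    exact hk (norm_le_zero_iff.1 h)
  let W := Submodule.span ℂ (Set.range u)
  let ℓ : W →ₗ[ℂ] ℂ := (Finsupp.linearCombination ℂ b).comp hli.repr
  have hbound : ∀ v : W, ‖ℓ v‖ ≤ C * B * ‖v‖ := by
    intro v
    have hv : Finsupp.linearCombination ℂ u (hli.repr v) = v := hli.linearCombination_repr v
    set a := hli.repr v with ha
    have hℓ : ℓ v = Finsupp.linearCombination ℂ b a := rfl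
    obtain ⟨N, hN, hN'⟩ := hsum X u a
    have hN2 : Finsupp.linearCombination ℂ b a = ∑ i ∈ Finset.range N, a i • b i := by
      rw [Finsupp.linearCombination_apply, Finsupp.sum_of_support_subset _ _ _ (by simp)]
      exact fun k hk => Finset.mem_range.2 (hN k hk)
    rw [hℓ, hN2]
    calc ‖∑ i ∈ Finset.range N, a i • b i‖ ≤ ∑ i ∈ Finset.range N, (C * ‖v‖) * ‖b i‖ := by
          refine norm_sum_le_of_le _ fun i hi => ?_
          rw [norm_smul]
          have := hu a N i (Finset.mem_range.1 hi)
          rw [← hN', hv] at this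
          exact mul_le_mul_of_nonneg_right this (norm_nonneg _)
      _ ≤ C * B * ‖v‖ := by
          rw [← Finset.mul_sum]
          have := mul_le_mul_of_nonneg_left (hB N) (by positivity : 0 ≤ C * ‖v‖)
          linarith
  obtain ⟨f, hf, hfn⟩ := exists_extension_norm_eq W (ℓ.mkContinuous (C * B) hbound)
  refine ⟨f, hfn ▸ LinearMap.mkContinuous_norm_le _ (by positivity) _, fun k => ?_⟩
  have h := hf ⟨u k, Submodule.subset_span ⟨k, rfl⟩⟩
  rw [LinearMap.mkContinuous_apply] at h
  have hr : hli.repr ⟨u k, Submodule.subset_span ⟨k, rfl⟩⟩ = Finsupp.single k 1 :=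
    hli.repr_eq_single k _ rfl
  change f (u k) = Finsupp.linearCombination ℂ b (hli.repr _) at h
  rw [h, hr]
  simp

/-- A nonempty countable closed subset of `ℂ` has an isolated point. -/
theorem IsClosed.exists_isolated_of_countable {S : Set ℂ} (hS : IsClosed S) (hc : S.Countable)
    (hne : S.Nonempty) : ∃ z ∈ S, ∀ᶠ w in 𝓝[≠] z, w ∉ S := by
  by_contra! h
  have hperf : Perfect S := ⟨hS, fun z hz => by
    rw [accPt_iff_frequently_nhdsNE]
    exact h z hz⟩
  obtain ⟨g, hgS, -, hg⟩ := hperf.exists_nat_bool_injection hne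
  have hcr := (hc.mono hgS).to_subtype
  have : Countable (ℕ → Bool) := (Equiv.ofInjective g hg).injective.countable
  obtain ⟨k, hk⟩ := exists_injective_nat (ℕ → Bool)
  classical
  refine Function.cantor_injective (fun s : Set ℕ => k fun n => decide (n ∈ s)) ?_
  intro s t hst
  ext n
  simpa using congrFun (hk hst) n

/-- If `T` has countable spectrum and no eigenvalues, then the local resolvent of a nonzero vector
blows up somewhere. -/
theorem exists_seq_localResolvent_unbounded {X : Type*} [NormedAddCommGroup X] [NormedSpace ℂ X]
    [CompleteSpace X] (T : X →L[ℂ] X) (hσ : (spectrum ℂ T).Countable)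
    (hinj : ∀ μ : ℂ, Function.Injective fun y : X => μ • y - T y) {x : X} (hx : x ≠ 0) :
    ∃ (z : ℂ) (l : ℕ → ℂ) (h : ℕ → X), Tendsto l atTop (𝓝 z) ∧
      (∀ n, l n • h n - T (h n) = x) ∧ ∀ n : ℕ, (n : ℝ) < ‖h n‖ := by
  classical
  have : Nontrivial X := ⟨x, 0, hx⟩
  let h : ℂ → X := fun μ => if H : ∃ v, μ • v - T v = x then H.choose else 0
  have hspec : ∀ {μ : ℂ} {v : X}, μ • v - T v = x → h μ = v := by
    intro μ v hv
    have H : ∃ v, μ • v - T v = x := ⟨v, hv⟩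
    have h1 : h μ = H.choose := dif_pos H
    rw [h1]
    exact hinj μ (H.choose_spec.trans hv.symm)
  have hres : ∀ μ ∉ spectrum ℂ T, h μ = resolvent T μ x ∧ μ • h μ - T (h μ) = x := by
    intro μ hμ
    have hu : IsUnit (algebraMap ℂ (X →L[ℂ] X) μ - T) := spectrum.notMem_iff.1 hμ
    have h1 : μ • resolvent T μ x - T (resolvent T μ x) = x := by
      have := congrArg (fun S : X →L[ℂ] X => S x) (Ring.mul_inverse_cancel _ hu)
      simpa [resolvent, Algebra.algebraMap_eq_smul_one] using this
    have h2 := hspec h1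
    exact ⟨h2, h2 ▸ h1⟩
  let Q : ℂ → Prop := fun μ => DifferentiableAt ℂ h μ ∧ μ • h μ - T (h μ) = x
  let S : Set ℂ := {μ | ∀ᶠ w in 𝓝 μ, Q w}ᶜ
  have hSc : IsClosed S := by
    rw [isClosed_compl_iff, isOpen_iff_mem_nhds]
    intro μ hμ
    exact eventually_eventually_nhds.2 hμ
  have hSσ : S ⊆ spectrum ℂ T := by
    intro μ hμ
    by_contra hn
    refine hμ ?_
    have ho : ∀ᶠ w in 𝓝 μ, w ∉ spectrum ℂ T := (spectrum.isClosed T).isOpen_compl.mem_nhds hn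
    filter_upwards [eventually_eventually_nhds.2 ho] with w hw
    refine ⟨?_, (hres w hw.self_of_nhds).2⟩
    have h1 : h =ᶠ[𝓝 w] fun μ => resolvent T μ x := hw.mono fun μ hμ => (hres μ hμ).1
    refine DifferentiableAt.congr_of_eventuallyEq ?_ h1
    have h2 := (spectrum.hasDerivAt_resolvent_const_left (𝕜 := ℂ) (a := T) (k := w)
      (not_not.1 hw.self_of_nhds)).differentiableAt
    exact h2.clm_apply (differentiableAt_const x)
  have hSne : S.Nonempty := by
    by_contra hemp
    have hall : ∀ μ, Q μ := fun μ => by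
      by_contra hμ
      exact hemp ⟨μ, fun h' => hμ h'.self_of_nhds⟩
    have hlim : Tendsto h (cocompact ℂ) (𝓝 0) := by
      rw [← Metric.cobounded_eq_cocompact]
      have h1 : Tendsto (fun μ => resolvent T μ x) (Bornology.cobounded ℂ) (𝓝 0) := by
        have := ((ContinuousLinearMap.apply ℂ X x).continuous.tendsto 0).comp
          (spectrum.resolvent_tendsto_cobounded (𝕜 := ℂ) T)
        rw [map_zero] at this
        exact this
      refine h1.congr' ?_
      filter_upwards [spectrum.eventually_isUnit_resolvent (𝕜 := ℂ) T] with μ hμ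
      exact (hres μ (spectrum.notMem_iff.2
        (spectrum.mem_resolventSet_iff.1 (spectrum.isUnit_resolvent.2 hμ)))).1.symm
    have hd : Differentiable ℂ h := fun μ => (hall μ).1
    have h0 := hd.apply_eq_of_tendsto_cocompact 0 hlim
    have := (hall 0).2
    rw [h0] at this
    exact hx (by simpa using this.symm)
  obtain ⟨z, hzS, hz⟩ := hSc.exists_isolated_of_countable (hσ.mono hSσ) hSne
  have hzQ : ∀ᶠ w in 𝓝[≠] z, Q w := hz.mono fun w hw => (not_not.1 hw).self_of_nhds
  have hunb : ∀ N : ℝ, ∃ᶠ w in 𝓝[≠] z, N < ‖h w‖ := by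
    intro N hN
    simp only [not_lt] at hN
    have hlim := Complex.tendsto_limUnder_of_differentiable_on_punctured_nhds_of_bounded_under
      (hzQ.mono fun w hw => hw.1)
      (isBoundedUnder_of_eventually_le (a := N + ‖h z‖) (hN.mono fun w hw =>
        (norm_sub_le _ _).trans (by gcongr)))
    set v := limUnder (𝓝[≠] z) h
    have hid : Tendsto (fun w : ℂ => w) (𝓝[≠] z) (𝓝 z) := tendsto_id.mono_left nhdsWithin_le_nhds
    have h1 : Tendsto (fun w => w • h w - T (h w)) (𝓝[≠] z) (𝓝 (z • v - T v)) :=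
      (hid.smul hlim).sub ((T.continuous.tendsto v).comp hlim)
    have h2 : z • v - T v = x := tendsto_nhds_unique
      (h1.congr' (hzQ.mono fun w hw => hw.2)) tendsto_const_nhds
    have hhz := hspec h2
    have hcont : ContinuousAt h z := by
      rw [continuousAt_iff_punctured_nhds, hhz]
      exact hlim
    have han := Complex.analyticAt_of_differentiable_on_punctured_nhds_of_continuousAt
      (hzQ.mono fun w hw => hw.1) hcont
    refine hzS ?_
    have h3 := eventually_nhdsWithin_iff.1 hzQ
    filter_upwards [h3] with w hw
    by_cases hwz : w = z
    · subst hwz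
      exact ⟨han.differentiableAt, hhz ▸ h2⟩
    · exact hw hwz
  have hex : ∀ n : ℕ, ∃ w : ℂ, (n : ℝ) < ‖h w‖ ∧ Q w ∧ dist w z < 1 / ((n : ℝ) + 1) := by
    intro n
    have hb : ∀ᶠ w in 𝓝[≠] z, dist w z < 1 / ((n : ℝ) + 1) :=
      nhdsWithin_le_nhds (Metric.ball_mem_nhds z (by positivity))
    exact ((hunb n).and_eventually (hzQ.and hb)).exists
  choose l hl1 hl2 hl3 using hex
  refine ⟨z, l, fun n => h (l n), ?_, fun n => (hl2 n).2, hl1⟩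
  rw [tendsto_iff_dist_tendsto_zero]
  exact squeeze_zero (fun _ => dist_nonneg) (fun n => (hl3 n).le)
    tendsto_one_div_add_atTop_nhds_zero_nat

/-- An approximate eigenvector sequence of an injective `z - T` has no nonzero weak limits. -/
theorem eq_zero_of_tendsto_dual_apply {X : Type*} [NormedAddCommGroup X] [NormedSpace ℂ X]
    {T : X →L[ℂ] X} {z : ℂ} (hinj : Function.Injective fun y : X => z • y - T y)
    {U : Filter ℕ} [U.NeBot] {y : ℕ → X} (hy : Tendsto (fun n => z • y n - T (y n)) U (𝓝 0))
    {v : X} (hv : ∀ f : StrongDual ℂ X, Tendsto (fun n => f (y n)) U (𝓝 (f v))) : v = 0 := by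
  refine hinj ?_
  simp only [smul_zero, map_zero, sub_zero]
  refine SeparatingDual.eq_zero_of_forall_dual_eq_zero (R := ℂ) fun f => ?_
  have h1 : Tendsto (fun n => f (z • y n - T (y n))) U (𝓝 0) := by
    have := (f.continuous.tendsto 0).comp hy
    rwa [map_zero] at this
  have h2 : Tendsto (fun n => f (z • y n - T (y n))) U (𝓝 (f (z • v - T v))) :=
    hv (f.comp (z • ContinuousLinearMap.id ℂ X - T))
  exact tendsto_nhds_unique h2 h1

/-- The closed span of every other term of a sequence with biorthogonal functionals is a
halfspace. -/
theorem isHalfspace_topologicalClosure_span_even {X : Type*} [NormedAddCommGroup X]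
    [NormedSpace ℂ X] {u : ℕ → X} {g : ℕ → StrongDual ℂ X}
    (hg : ∀ j k, g j (u k) = if k = j then 1 else 0) :
    IsHalfspace (Submodule.span ℂ (Set.range fun k => u (2 * k))).topologicalClosure := by
  set Y := (Submodule.span ℂ (Set.range fun k => u (2 * k))).topologicalClosure with hY
  have hmem : ∀ k, u (2 * k) ∈ Y := fun k =>
    Submodule.le_topologicalClosure _ (Submodule.subset_span ⟨k, rfl⟩)
  have hann : ∀ j, ∀ v ∈ Y, g (2 * j + 1) v = 0 := by
    intro j
    have hle : Y ≤ LinearMap.ker (g (2 * j + 1)).toLinearMap := by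
      refine Submodule.topologicalClosure_minimal _ ?_ (g (2 * j + 1)).isClosed_ker
      rw [Submodule.span_le]
      rintro _ ⟨k, rfl⟩
      change g (2 * j + 1) (u (2 * k)) = 0
      rw [hg, if_neg (by omega)]
    exact fun v hv => hle hv
  refine ⟨Submodule.isClosed_topologicalClosure _, fun hfin => ?_, fun hfin => ?_⟩
  · have hli : LinearIndependent ℂ fun k => (⟨u (2 * k), hmem k⟩ : Y) := by
      rw [linearIndependent_iff']
      intro s a ha i hi
      have h := congrArg (fun v : Y => g (2 * i) v) ha
      simpa [hg, hi] using h
    have := hli.finite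
    exact not_finite ℕ
  · have hli : LinearIndependent ℂ fun k => Y.mkQ (u (2 * k + 1)) := by
      rw [linearIndependent_iff']
      intro s a ha i hi
      simp_rw [← map_smul] at ha
      rw [← map_sum, ← LinearMap.mem_ker, Submodule.ker_mkQ] at ha
      have h := hann i _ ha
      simpa [hg, hi] using h
    have := hli.finite
    exact not_finite ℕ

theorem mainTheorem5 {X : Type*} [NormedAddCommGroup X] [NormedSpace ℂ X] [CompleteSpace X]
    (hX : ¬ FiniteDimensional ℂ X) (T : X →L[ℂ] X)
    (hσ : (spectrum ℂ T).Countable) (hp : pointSpectrum T = ∅)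
    (x : X) (hx : x ≠ 0) (ε : ℝ) (hε : 0 < ε) :
    ∃ F : X →L[ℂ] X, ‖F‖ < ε ∧
      LinearMap.range (F : X →ₗ[ℂ] X) = Submodule.span ℂ {x} ∧
      ∃ Y : Submodule ℂ X, IsInvariantHalfspace (T - F) Y ∧
        Submodule.map (T : X →ₗ[ℂ] X) Y ≤ Y ⊔ Submodule.span ℂ {x} := by
  have hinj : ∀ μ : ℂ, Function.Injective fun y : X => μ • y - T y := fun μ => by
    by_contra h
    exact Set.notMem_empty μ (hp ▸ h)
  obtain ⟨z, l, h, hl, hlh, hn⟩ := exists_seq_localResolvent_unbounded T hσ hinj hx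
  have hhpos : ∀ n, 0 < ‖h n‖ := fun n => (Nat.cast_nonneg n).trans_lt (hn n)
  set c : ℕ → ℂ := fun n => (‖h n‖ : ℂ)⁻¹ with hc
  have hc0 : ∀ n, c n ≠ 0 := fun n => inv_ne_zero (by exact_mod_cast (hhpos n).ne')
  have hcn : ∀ n, ‖c n‖ = ‖h n‖⁻¹ := fun n => by simp [hc]
  have hclim : Tendsto (fun n => ‖c n‖) atTop (𝓝 0) := by
    simp_rw [hcn]
    exact tendsto_inv_atTop_zero.comp
      (tendsto_atTop_mono (fun n => (hn n).le) tendsto_natCast_atTop_atTop)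
  set y : ℕ → X := fun n => c n • h n with hydef
  have hy : ∀ n, ‖y n‖ = 1 := fun n => by
    rw [hydef, norm_smul, hcn, inv_mul_cancel₀ (hhpos n).ne']
  have hTy : ∀ n, T (y n) = l n • y n - c n • x := fun n => by
    rw [← hlh n, smul_sub, ← map_smul, smul_comm (c n) (l n)]
    abel
  have happrox : Tendsto (fun n => z • y n - T (y n)) atTop (𝓝 0) := by
    have h1 : Tendsto (fun n => ‖l n - z‖ + ‖c n‖ * ‖x‖) atTop (𝓝 0) := by
      simpa using (tendsto_iff_norm_sub_tendsto_zero.1 hl).add (hclim.mul_const ‖x‖)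
    refine squeeze_zero_norm (fun n => ?_) h1
    have : z • y n - T (y n) = c n • x - (l n - z) • y n := by
      rw [hTy, sub_smul]; abel
    rw [this]
    refine (norm_sub_le _ _).trans ?_
    rw [norm_smul, norm_smul, hy, mul_one, add_comm]
  obtain ⟨ζ, hζ⟩ := exists_tendsto_dual_apply (hyperfilter ℕ) hy
  obtain ⟨C, hC, hsub⟩ := exists_bound_forall_exists_subseq (inclusionInDoubleDualLi (E := X) ℂ)
    (U := (hyperfilter ℕ : Filter ℕ)) hy hζ (fun v hv =>
      eq_zero_of_tendsto_dual_apply (hinj z) (happrox.mono_left Nat.hyperfilter_le_atTop)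
        fun f => by
          have := hζ f
          rwa [← hv] at this)
  have hxpos : 0 < ‖x‖ := norm_pos_iff.2 hx
  set δ : ℝ := ε / (4 * C * ‖x‖) with hδ
  have hδpos : 0 < δ := by positivity
  obtain ⟨φ, hφ, hcoef⟩ := hsub (fun k n => ‖c n‖ ≤ δ * (1 / 2) ^ k) fun k =>
    ((hclim.mono_left Nat.hyperfilter_le_atTop).eventually_le_const (by positivity))
  obtain ⟨f, hfn, hf⟩ := exists_dual_apply_eq (u := fun k => y (φ k)) hC hcoef
    (b := fun k => -c (φ k)) (B := 2 * δ) (fun N => by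
      calc ∑ i ∈ Finset.range N, ‖-c (φ i)‖
          ≤ ∑ i ∈ Finset.range N, δ * (1 / 2) ^ i :=
            Finset.sum_le_sum fun i _ => by rw [norm_neg]; exact hφ i
        _ ≤ 2 * δ := by
            rw [← Finset.mul_sum, mul_comm 2]
            exact mul_le_mul_of_nonneg_left (sum_geometric_two_le N) hδpos.le)
  have hg : ∀ j, ∃ g : StrongDual ℂ X, ∀ k, g (y (φ k)) = if k = j then 1 else 0 := fun j => by
    obtain ⟨g, -, hg⟩ := exists_dual_apply_eq (u := fun k => y (φ k)) hC hcoef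
      (b := fun k => if k = j then 1 else 0) (B := 1) (fun N => by
        simp only [apply_ite norm, norm_one, norm_zero, Finset.sum_ite_eq']
        split_ifs <;> norm_num)
    exact ⟨g, hg⟩
  choose g hg using hg
  have hFn : ‖f.smulRight x‖ < ε := by
    rw [ContinuousLinearMap.norm_smulRight_apply]
    calc ‖f‖ * ‖x‖ ≤ C * (2 * δ) * ‖x‖ := by gcongr
      _ = ε / 2 := by rw [hδ]; field_simp; norm_num
      _ < ε := by linarith
  have hrange : LinearMap.range (f.smulRight x : X →ₗ[ℂ] X) = Submodule.span ℂ {x} := by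
    refine le_antisymm ?_ ?_
    · rintro _ ⟨v, rfl⟩
      exact Submodule.smul_mem _ _ (Submodule.mem_span_singleton_self x)
    · rw [Submodule.span_singleton_le_iff_mem]
      refine ⟨-(c (φ 0))⁻¹ • y (φ 0), ?_⟩
      simp [hf 0, hc0]
  set Y := (Submodule.span ℂ (Set.range fun k => y (φ (2 * k)))).topologicalClosure with hY
  have hinv : ∀ v ∈ Y, (T - f.smulRight x) v ∈ Y := by
    have hle : Y ≤ Y.comap (T - f.smulRight x).toLinearMap := by
      refine Submodule.topologicalClosure_minimal _ ?_
        ((Submodule.isClosed_topologicalClosure _).preimage (T - f.smulRight x).continuous)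
      rw [Submodule.span_le]
      rintro _ ⟨k, rfl⟩
      have h1 : (T - f.smulRight x) (y (φ (2 * k))) = l (φ (2 * k)) • y (φ (2 * k)) := by
        rw [sub_apply, ContinuousLinearMap.smulRight_apply, hf (2 * k), hTy,
          neg_smul]
        abel
      change (T - f.smulRight x) (y (φ (2 * k))) ∈ Y
      rw [h1]
      exact Submodule.smul_mem _ _
        (Submodule.le_topologicalClosure _ (Submodule.subset_span ⟨k, rfl⟩))
    exact fun v hv => hle hv
  refine ⟨f.smulRight x, hFn, hrange, Y,
    ⟨isHalfspace_topologicalClosure_span_even (u := fun k => y (φ k)) hg, hinv⟩, ?_⟩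
  rintro _ ⟨v, hv, rfl⟩
  have h1 : T v = (T - f.smulRight x) v + f v • x := by simp
  change T v ∈ _
  rw [h1]
  exact Submodule.add_mem_sup (hinv v hv)
    (Submodule.smul_mem _ _ (Submodule.mem_span_singleton_self x))
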